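/- Fix $n\ge 3$. For $k\ge 1$ let $\mathcal L_k$ be the lattice of all partitions of $k$, i.e. of all $k$-tuples $\alpha=(a_1,\dots,a_k)$ of natural numbers with $a_1\ge\dots\ge a_k\ge 0$ and $a_1+\dots+a_k=k$, under the dominance order: $\alpha\ge\beta$ iff $\sum_{i=1}^j a_i\ge\sum_{i=1}^j b_i$ for all $j\ge 1$. Put $a_i=0$ for $i>k$; trailing zeros of a tuple may be omitted. Let $\mathcal J(\mathcal L_k)$ be the set of join-irreducible elements of $\mathcal L_k$ (those $\alpha$ that are not the minimum and for which $\alpha=\beta\vee\gamma$ implies $\alpha=\beta$ or $\alpha=\gamma$). Let $d_j(\alpha)=a_j-a_{j+1}$. We say that $\alpha$ has - a cliff at $j$ if $d_j(\alpha)\ge 2$; - a slippery plateau of length $l\ge 1$ at $j$ if $d_i(\alpha)=0$ for $j\le i<j+l$ and $d_{j+l}(\alpha)=1$; - a non-slippery plateau at $j$ if there is $k>j$ with $d_i(\alpha)=0$ for $j\le i<k$ and a cliff at $k$; - a slippery (respectively non-slippery) step at $j$ if the tuple obtained from $\alpha$ by replacing $a_j$ by $a_j-1$ is a partition which has a slippery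 plateau, of some length $l\ge1$ (respectively, a non-slippery plateau), at $j$. Let $\mathrm{Cl}(n)$, $\mathrm{NP}(n)$, $\mathrm{SS}(n)$, $\mathrm{NS}(n)$ be the sets of all partitions of $n$ having, at $1$, a cliff, a non-slippery plateau, a slippery step, a non-slippery step, respectively, and let $\mathrm{PP}_l(n)$ be the set of those having a slippery plateau of length $l$ at $1$. For $A\subseteq\mathcal L_n$ and $1\le i\le n+1$ let $A^{\downarrow_i}$ be the set of all tuples obtained from members of $A$ (prolonged by zeros) by adding $1$ to the $i$-th entry. Then $$\begin{aligned}\mathcal J(\mathcal L_{n+1})={}&(\mathcal J(\mathcal L_n)\cap \mathrm{Cl}(n))^{\downarrow_1}\sqcup(\mathcal J(\mathcal L_n)\cap \mathrm{NP}(n))^{\downarrow_1}\sqcup(\mathcal J(\mathcal L_n)\cap \mathrm{SS}(n))^{\downarrow_2}\sqcup(\mathcal J(\mathcal L_n)\cap \mathrm{NS}(n))^{\downarrow_2}\\&\sqcup\bigsqcup_{1\le l<n}(\mathcal J(\mathcal L_n)\cap \mathrm{PP}_l(n))^{\downarrow_{l+2}}\sqcup E_1(n+1)\sqcup E_2(n+1),\end{aligned}$$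 where $\sqcup$ denotes the union of pairwise disjoint sets (the disjointness being part of the claim), $E_1(k)=\{(2,1,\dots,1)\}$ consists of the single partition of $k$ with first entry $2$ and all other nonzero entries $1$, and $E_2(k)$ is the set of all partitions of $k$ of the form $(3,\dots,3,1,\dots,1)$ with $m$ entries $3$ and $l$ entries $1$ for some $m\ge1$, $l\ge1$. -/

import Mathlib

open Finset

/-- A partition of `n`: a nonincreasing `n`-tuple of natural numbers with sum `n`, prolonged by
zeros to a sequence. Columns are numbered from `0`, so that `col j` is the entry `a_{j+1}` of the
tuple `(a_1, …, a_n)`. -/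
@[ext]
structure ColPartition (n : ℕ) where
  col : ℕ → ℕ
  anti : Antitone col
  col_eq_zero : ∀ i, n ≤ i → col i = 0
  sum_col : ∑ i ∈ range n, col i = n

namespace ColPartition

variable {n : ℕ}

/-- The sum of the first `j` entries. -/
def psum (α : ColPartition n) (j : ℕ) : ℕ := ∑ i ∈ range j, α.col i

theorem psum_succ (α : ColPartition n) (j : ℕ) : α.psum (j + 1) = α.psum j + α.col j :=
  Finset.sum_range_succ _ _

theorem psum_of_le (α : ColPartition n) {j : ℕ} (h : n ≤ j) : α.psum j = n := by
  induction j, h using Nat.le_induction with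
  | base => exact α.sum_col
  | succ j hj ih => rw [psum_succ, ih, α.col_eq_zero j hj, add_zero]

theorem psum_injective : Function.Injective (psum (n := n)) := by
  intro α β h
  ext j
  have h1 := congrFun h (j + 1)
  rw [psum_succ, psum_succ, congrFun h j] at h1
  omega

/-- The dominance order. -/
instance : PartialOrder (ColPartition n) where
  le α β := ∀ j, ∑ i ∈ range j, α.col i ≤ ∑ i ∈ range j, β.col i
  le_refl _ _ := le_rfl
  le_trans _ _ _ h h' j := (h j).trans (h' j)
  le_antisymm _ _ h h' := psum_injective (funext fun j => (h j).antisymm (h' j))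

theorem le_iff_psum {α β : ColPartition n} : α ≤ β ↔ ∀ j, α.psum j ≤ β.psum j := Iff.rfl

/-- A concave sequence starting at `0` and equal to `n` from index `n` on is the sequence of
partial sums of a partition. -/
theorem exists_psum_eq (F : ℕ → ℕ) (h0 : F 0 = 0) (hn : ∀ j, n ≤ j → F j = n)
    (hc : ∀ j, F (j + 2) + F j ≤ 2 * F (j + 1)) : ∃ α : ColPartition n, α.psum = F := by
  have hle : ∀ k j, j + k = n → F j ≤ F (j + 1) := by
    intro k
    induction k with
    | zero => intro j hj; rw [hn j (by omega), hn (j + 1) (by omega)]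
    | succ k ih =>
      intro j hj
      have h1 := ih (j + 1) (by omega)
      have h2 := hc j
      have h3 : j + 1 + 1 = j + 2 := rfl
      rw [h3] at h1
      omega
  have hmono : ∀ j, F j ≤ F (j + 1) := fun j => by
    rcases le_total j n with h | h
    · exact hle (n - j) j (by omega)
    · rw [hn j h, hn (j + 1) (by omega)]
  have hsum : ∀ j, ∑ i ∈ range j, (F (i + 1) - F i) = F j := by
    intro j
    induction j with
    | zero => simp [h0]
    | succ j ih => rw [Finset.sum_range_succ, ih]; have := hmono j; omega
  refine ⟨⟨fun i => F (i + 1) - F i, antitone_nat_of_succ_le fun i => ?_, fun i hi => ?_, ?_⟩, ?_⟩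
  · have h2 := hc i
    have h3 : i + 1 + 1 = i + 2 := rfl
    have := hmono i
    rw [h3]
    omega
  · rw [hn i hi, hn (i + 1) (by omega), Nat.sub_self]
  · rw [hsum, hn n le_rfl]
  · exact funext hsum

theorem psum_concave (α : ColPartition n) (j : ℕ) :
    α.psum (j + 2) + α.psum j ≤ 2 * α.psum (j + 1) := by
  have h1 := α.psum_succ (j + 1)
  have h2 := α.psum_succ j
  have h3 := α.anti (Nat.le_succ j)
  have h4 : j + 1 + 1 = j + 2 := rfl
  rw [h4] at h1
  simp only [Nat.succ_eq_add_one] at h3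
  omega

theorem psum_zero (α : ColPartition n) : α.psum 0 = 0 := Finset.sum_range_zero _

theorem psum_le (α : ColPartition n) (j : ℕ) : α.psum j ≤ n := by
  rcases le_total n j with h | h
  · exact (α.psum_of_le h).le
  · exact (Finset.sum_le_sum_of_subset (Finset.range_mono h)).trans_eq (α.psum_of_le le_rfl)

/-- The one-part partition `(n)` is the greatest element. -/
theorem exists_top : ∃ τ : ColPartition n, ∀ α : ColPartition n, α ≤ τ := by
  obtain ⟨τ, hτ⟩ := exists_psum_eq (n := n) (fun j => if j = 0 then 0 else n) (by simp)
    (fun j hj => by by_cases h : j = 0 <;> simp [h]; omega)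
    (fun j => by by_cases h : j = 0 <;> simp [h] <;> omega)
  refine ⟨τ, fun α j => ?_⟩
  change α.psum j ≤ τ.psum j
  rw [hτ]
  by_cases h : j = 0
  · simp [h, psum_zero]
  · simpa [h] using α.psum_le j

theorem exists_isGLB (S : Set (ColPartition n)) : ∃ γ, IsGLB S γ := by
  obtain ⟨τ, hτ⟩ := exists_top (n := n)
  let V : ℕ → Set ℕ := fun j => (fun α : ColPartition n => α.psum j) '' insert τ S
  have hV : ∀ j, ∃ α ∈ insert τ S, α.psum j = sInf (V j) := fun j =>
    Nat.sInf_mem (s := V j) ⟨_, τ, Set.mem_insert _ _, rfl⟩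
  have hVle : ∀ j, ∀ α ∈ insert τ S, sInf (V j) ≤ α.psum j := fun j α hα =>
    Nat.sInf_le ⟨α, hα, rfl⟩
  obtain ⟨γ, hγ⟩ := exists_psum_eq (n := n) (fun j => sInf (V j))
    (by obtain ⟨α, -, h⟩ := hV 0; rw [← h, psum_zero])
    (fun j hj => by obtain ⟨α, -, h⟩ := hV j; rw [← h, psum_of_le α hj])
    (fun j => by
      obtain ⟨α, hα, h⟩ := hV (j + 1)
      have h1 := hVle j α hα
      have h2 := hVle (j + 2) α hα
      have h3 := α.psum_concave j
      simp only [← h]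
      omega)
  refine ⟨γ, fun α hα j => ?_, fun δ hδ j => ?_⟩
  · change γ.psum j ≤ α.psum j
    rw [hγ]
    exact hVle j α (Set.mem_insert_of_mem _ hα)
  · change δ.psum j ≤ γ.psum j
    obtain ⟨α, hα, h⟩ := hV j
    rw [hγ]
    simp only [← h]
    rcases hα with rfl | hα
    · exact hτ δ j
    · exact hδ hα j

noncomputable instance : InfSet (ColPartition n) := ⟨fun S => (exists_isGLB S).choose⟩

/-- The partitions of `n` form a (complete) lattice under the dominance order. -/
noncomputable instance : CompleteLattice (ColPartition n) :=
  completeLatticeOfInf _ fun S => (exists_isGLB S).choose_spec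

end ColPartition

/-- The set of join-irreducible elements of the lattice of partitions of `n`. -/
def joinIrreducibles (n : ℕ) : Set (ColPartition n) := {α | SupIrred α}

/-- The height difference `a_j - a_{j+1}` of a sequence at column `j`. -/
def heightDiff (a : ℕ → ℕ) (j : ℕ) : ℤ := (a j : ℤ) - (a (j + 1) : ℤ)

/-- A cliff at column `j`. -/
def HasCliff (a : ℕ → ℕ) (j : ℕ) : Prop := 2 ≤ heightDiff a j

/-- A slippery plateau of length `l` at column `j`. -/
def HasSlipperyPlateau (a : ℕ → ℕ) (j l : ℕ) : Prop :=
  ∃ k, j < k ∧ (∀ i, j ≤ i → i < k → heightDiff a i = 0) ∧ heightDiff a k = 1 ∧ l = k - j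

/-- A non-slippery plateau (of some length) at column `j`. -/
def HasNonSlipperyPlateau (a : ℕ → ℕ) (j : ℕ) : Prop :=
  ∃ k, j < k ∧ (∀ i, j ≤ i → i < k → heightDiff a i = 0) ∧ HasCliff a k

/-- The sequence `a` with one grain removed from column `j`. -/
def removeGrain (j : ℕ) (a : ℕ → ℕ) : ℕ → ℕ := Function.update a j (a j - 1)

/-- Removing a grain from column `j` leaves a partition. -/
def CanRemoveGrain (a : ℕ → ℕ) (j : ℕ) : Prop := 1 ≤ a j ∧ Antitone (removeGrain j a)

/-- A slippery step at column `j`. -/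
def HasSlipperyStep (a : ℕ → ℕ) (j : ℕ) : Prop :=
  CanRemoveGrain a j ∧ ∃ l, HasSlipperyPlateau (removeGrain j a) j l

/-- A non-slippery step at column `j`. -/
def HasNonSlipperyStep (a : ℕ → ℕ) (j : ℕ) : Prop :=
  CanRemoveGrain a j ∧ HasNonSlipperyPlateau (removeGrain j a) j

/-! The classes of partitions of `n` according to their shape at the first column. -/

def Cl (n : ℕ) : Set (ColPartition n) := {α | HasCliff α.col 0}

def NP (n : ℕ) : Set (ColPartition n) := {α | HasNonSlipperyPlateau α.col 0}

def SS (n : ℕ) : Set (ColPartition n) := {α | HasSlipperyStep α.col 0}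

def NS (n : ℕ) : Set (ColPartition n) := {α | HasNonSlipperyStep α.col 0}

def PP (l n : ℕ) : Set (ColPartition n) := {α | HasSlipperyPlateau α.col 0 l}

/-- Add one grain to the `i`-th column of a partition, where here `i = 1, 2, …` counts the columns
from `1`, so that the `i`-th column has index `i - 1`. The result is a sequence which need not be
nonincreasing. -/
def addGrain {n : ℕ} (i : ℕ) (α : ColPartition n) : ℕ → ℕ :=
  fun j => if j + 1 = i then α.col j + 1 else α.col j

/-- The set of all sequences obtained from members of `A` by adding a grain to the `i`-th column,
counted from `1`. -/
def grainImage {n : ℕ} (A : Set (ColPartition n)) (i : ℕ) : Set (ℕ → ℕ) := addGrain i '' A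

/-- A finite tuple, prolonged by zeros. -/
def tuple (L : List ℕ) : ℕ → ℕ := fun i => L.getD i 0

/-- The set `{(2,1,…,1)}`, where the entries sum to `k` (for `k ≥ 2`). -/
def E₁ (k : ℕ) : Set (ℕ → ℕ) := {tuple (2 :: List.replicate (k - 2) 1)}

/-- The set of all partitions of `k` of the form `(3,…,3,1,…,1)`, with `m ≥ 1` entries `3` and
`l ≥ 1` entries `1`. -/
def E₂ (k : ℕ) : Set (ℕ → ℕ) :=
  {a | ∃ m l : ℕ, 1 ≤ m ∧ 1 ≤ l ∧ 3 * m + l = k ∧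
    a = tuple (List.replicate m 3 ++ List.replicate l 1)}

/-! A partition is join-irreducible iff there is a greatest partition strictly below it. The maximal
smaller partitions arise from drop pairs: a grain slides down a cliff, or from a unit descent across
a plateau to just behind the next unit descent. This lowers the partial sums by one on an interval,
and anything strictly smaller lies strictly below on such an interval. So join-irreducible means
having exactly one drop pair (`supIrred_iff`).

A single drop pair leaves room only for one cliff with at most one unit descent on either side, or
for just two unit descents (`exists_validShape`). Read by rows, this is one row of length `p`, `c`
rows of length `q` and one row of length `r`, where `p = 0` or `r = 0` means an absent row. These
parameters are unique (`ValidShape.shape_injective`).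

Each class at the first column is a condition on the parameters, and the prescribed grain always
extends the short row from `p` to `p + 1`; this row joins the middle rows if `q = p + 1`. Undoing
the move fails only for `p = c = 1`, which is `E₁`, and for `p = 0`, `c = 2`, `r ≥ 1`, which is
`E₂`; the remaining failure, `(1, 1)` by rows, is too small to occur. -/

/-! ### Drop pairs of a difference sequence -/

/-- A cliff at `p = q`, or two consecutive descents `p < q`, both of height one, of a sequence with
differences `d`. -/
def IsDropPair (d : ℕ → ℤ) (p q : ℕ) : Prop :=
  p = q ∧ 2 ≤ d p ∨ p < q ∧ d p = 1 ∧ d q = 1 ∧ ∀ i, p < i → i < q → d i = 0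

theorem IsDropPair.le {d : ℕ → ℤ} {p q : ℕ} (h : IsDropPair d p q) : p ≤ q := by
  rcases h with h | h <;> omega

/-- The two ends of a non-cliff pair are consecutive unit descents, so distinct pairs can only share
an end, where one stops and the other starts. -/
theorem IsDropPair.eq_one_of_overlap {d : ℕ → ℤ} {p q p' q' j : ℕ} (h : IsDropPair d p q)
    (h' : IsDropPair d p' q') (hne : ¬(p = p' ∧ q = q')) (hp : p ≤ j) (hq : j ≤ q) (hp' : p' ≤ j)
    (hq' : j ≤ q') : d j = 1 ∧ (j = p ∧ j = q' ∨ j = q ∧ j = p') := by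
  rcases h with ⟨rfl, h⟩ | ⟨h1, h2, h3, h4⟩ <;> rcases h' with ⟨rfl, h'⟩ | ⟨h1', h2', h3', h4'⟩
  · omega
  · obtain rfl : p = j := by omega
    have := h4' p
    grind
  · obtain rfl : p' = j := by omega
    have := h4 p'
    grind
  · have a1 := h4 p'
    have a2 := h4 q'
    have a3 := h4' p
    have a4 := h4' q
    have a5 := h4 j
    grind

/-- Take the first descent `k` after `i`: either `i` or `k` is a cliff, or the two form a pair of
unit descents. -/
theorem exists_isDropPair_of_lt {d : ℕ → ℤ} (hd : ∀ i, 0 ≤ d i) {i j : ℕ} (hij : i < j)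
    (hi : 1 ≤ d i) (hj : 1 ≤ d j) : ∃ p q, IsDropPair d p q ∧ i ≤ p ∧ q ≤ j := by
  have hex : ∃ k, i < k ∧ 1 ≤ d k := ⟨j, hij, hj⟩
  classical
  obtain ⟨h1, h2⟩ := Nat.find_spec hex
  have h3 : Nat.find hex ≤ j := Nat.find_min' hex ⟨hij, hj⟩
  have h4 : ∀ l, i < l → l < Nat.find hex → d l = 0 := fun l hl hl' => by
    have := Nat.find_min hex hl'
    have := hd l
    grind
  generalize Nat.find hex = k at *
  by_cases hi2 : 2 ≤ d i
  · exact ⟨i, i, .inl ⟨rfl, hi2⟩, le_rfl, hij.le⟩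
  by_cases hk2 : 2 ≤ d k
  · exact ⟨k, k, .inl ⟨rfl, hk2⟩, h1.le, h3⟩
  exact ⟨i, k, .inr ⟨h1, by omega, by omega, h4⟩, le_rfl, h3⟩

theorem exists_isDropPair_of_sum {d : ℕ → ℤ} (hd : ∀ i, 0 ≤ d i) {a m : ℕ}
    (h : 2 ≤ ∑ i ∈ range m, d (a + i)) : ∃ p q, IsDropPair d p q ∧ a ≤ p ∧ q < a + m := by
  obtain ⟨i, hi, hi0⟩ : ∃ i ∈ range m, 0 < d (a + i) :=
    exists_lt_of_sum_lt (by simp only [sum_const_zero]; omega)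
  by_cases hi2 : 2 ≤ d (a + i)
  · exact ⟨a + i, a + i, .inl ⟨rfl, hi2⟩, by omega, by simpa using hi⟩
  rw [← add_sum_erase _ _ hi] at h
  obtain ⟨j, hj, hj0⟩ : ∃ j ∈ (range m).erase i, 0 < d (a + j) :=
    exists_lt_of_sum_lt (by simp only [sum_const_zero]; omega)
  simp only [mem_erase, mem_range] at hj hi
  rcases lt_or_gt_of_ne hj.1 with hij | hij
  · obtain ⟨p, q, h1, h2, h3⟩ := exists_isDropPair_of_lt hd (i := a + j) (j := a + i)
      (by omega) (by omega) (by omega)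
    exact ⟨p, q, h1, by omega, by omega⟩
  · obtain ⟨p, q, h1, h2, h3⟩ := exists_isDropPair_of_lt hd (i := a + i) (j := a + j)
      (by omega) (by omega) (by omega)
    exact ⟨p, q, h1, by omega, by omega⟩

/-! ### Join-irreducibility in the dominance order -/

namespace ColPartition

variable {n : ℕ}

theorem heightDiff_nonneg (α : ColPartition n) (i : ℕ) : 0 ≤ heightDiff α.col i := by
  have := α.anti (Nat.le_succ i)
  simp only [heightDiff, Nat.succ_eq_add_one] at *
  omega

theorem heightDiff_eq_psum (α : ColPartition n) (i : ℕ) :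
    heightDiff α.col i = 2 * (α.psum (i + 1) : ℤ) - α.psum i - α.psum (i + 2) := by
  have h1 := α.psum_succ (i + 1)
  have h2 := α.psum_succ i
  rw [show i + 1 + 1 = i + 2 from rfl] at h1
  simp only [heightDiff]
  omega

/-- Moving one grain down along a drop pair. -/
theorem exists_psum_eq_sub (α : ColPartition n) {p q : ℕ}
    (h : IsDropPair (heightDiff α.col) p q) :
    ∃ β : ColPartition n, ∀ i, β.psum i + (if p < i ∧ i ≤ q + 1 then 1 else 0) = α.psum i := by
  have hpq := h.le
  have hq1 : 1 ≤ α.col q := by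
    rcases h with ⟨rfl, h⟩ | ⟨-, -, h, -⟩ <;> simp only [heightDiff] at h <;> omega
  have hp2 : 2 ≤ α.col p := by
    rcases h with ⟨rfl, h⟩ | ⟨h0, h, -, -⟩
    · simp only [heightDiff] at h; omega
    · have := α.anti (Nat.succ_le_of_lt h0)
      simp only [heightDiff, Nat.succ_eq_add_one] at *; omega
  -- Columns `0` to `q` are nonempty and column `p` holds two grains, so the moved grain lands
  -- inside the tuple and the partial sums from `n` on stay equal to `n`.
  have hqn : q + 1 < n := by
    refine lt_of_lt_of_le ?_ (α.psum_le (q + 1))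
    have : ∑ _i ∈ range (q + 1), 1 < α.psum (q + 1) := by
      refine sum_lt_sum (fun i hi => hq1.trans (α.anti ?_)) ⟨p, ?_, hp2⟩
      · simp only [mem_range] at hi; omega
      · simp only [mem_range]; omega
    simpa using this
  have hpos : ∀ i, p < i → 1 ≤ α.psum i := fun i hi =>
    (hp2.trans' one_le_two).trans
      (single_le_sum (f := α.col) (fun _ _ => Nat.zero_le _) (mem_range.2 hi))
  obtain ⟨β, hβ⟩ := exists_psum_eq (n := n)
    (fun i => α.psum i - (if p < i ∧ i ≤ q + 1 then 1 else 0)) (by simp [psum_zero])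
    (fun j hj => by
      have := α.psum_of_le hj
      rw [if_neg (by omega)]; omega)
    (fun j => by
      have h0 := α.heightDiff_nonneg j
      have h1 := α.heightDiff_eq_psum j
      have p1 := hpos j
      have p2 := hpos (j + 1)
      have p3 := hpos (j + 2)
      -- Lowering the middle value costs 2 in the second difference; each neighbour that is lowered
      -- as well gives 1 back.
      have key : p ≤ j → j ≤ q → 2 ≤ heightDiff α.col j + (if j < q then 1 else 0)
          + (if p < j then 1 else 0) := by
        intro hp hq
        rcases h with ⟨rfl, h⟩ | ⟨hlt, e1, e2, -⟩
        · obtain rfl : p = j := by omega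
          simpa using h
        · rcases hp.eq_or_lt with rfl | hp
          · rw [if_pos hlt, e1]; simp
          · rcases hq.eq_or_lt with rfl | hq
            · rw [if_pos hp, e2]; simp
            · rw [if_pos hp, if_pos hq]; omega
      split_ifs at * <;> omega)
  refine ⟨β, fun i => ?_⟩
  rw [hβ]
  have := hpos i
  dsimp only
  split_ifs <;> omega

/-- Between consecutive zeros of the gap of partial sums, the gap rises from 0 and returns to 0. Its
slope thus falls by at least 2, and only descents of `α` can cause this. -/
theorem exists_isDropPair_of_gt {α β : ColPartition n} (h : β < α) :
    ∃ p q, IsDropPair (heightDiff α.col) p q ∧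
      ∀ i, p < i → i ≤ q + 1 → β.psum i < α.psum i := by
  have hle : ∀ i, β.psum i ≤ α.psum i := h.le
  obtain ⟨k, hk⟩ : ∃ k, β.psum k < α.psum k := by
    by_contra! hc
    exact h.not_ge hc
  classical
  have hb : ∃ m, β.psum (k + m) = α.psum (k + m) :=
    ⟨n, by rw [psum_of_le _ (by omega), psum_of_le _ (by omega)]⟩
  have ha : ∃ m, β.psum (k - m) = α.psum (k - m) := ⟨k, by simp [psum_zero]⟩
  -- The nearest zeros of the gap on either side of `k`.
  obtain ⟨a, b, hak, hkb, hDa, hDb, hD⟩ : ∃ a b, a < k ∧ k < b ∧ β.psum a = α.psum a ∧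
      β.psum b = α.psum b ∧ ∀ i, a < i → i < b → β.psum i < α.psum i := by
    have h1 := Nat.find_spec hb
    have h2 := Nat.find_spec ha
    refine ⟨k - Nat.find ha, k + Nat.find hb, ?_, ?_, h2, h1, fun i hi hi' => ?_⟩
    · by_contra hc
      rw [show k - Nat.find ha = k by omega] at h2
      omega
    · by_contra hc
      rw [show k + Nat.find hb = k by omega] at h1
      omega
    · rcases le_total k i with hki | hki
      · have h3 := Nat.find_min hb (m := i - k) (by omega)
        rw [show k + (i - k) = i by omega] at h3
        have := hle i
        omega
      · have h3 := Nat.find_min ha (m := k - i) (by omega)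
        rw [show k - (k - i) = i by omega] at h3
        have := hle i
        omega
  obtain ⟨m, rfl⟩ : ∃ m, b = a + m + 1 := ⟨b - a - 1, by omega⟩
  let e : ℕ → ℤ := fun i =>
    (α.psum (a + i + 1) - β.psum (a + i + 1) : ℤ) - (α.psum (a + i) - β.psum (a + i))
  -- The slope `e` is at least 1 at the left end and at most -1 at the right end; its decrease at
  -- each step is the difference of the descents of `α` and `β`.
  have hsum : 2 ≤ ∑ i ∈ range m, heightDiff α.col (a + i) := by
    calc (2 : ℤ) ≤ e 0 - e m := by
          have h1 := hD (a + 1) (by omega) (by omega)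
          have h2 := hD (a + m) (by omega) (by omega)
          simp only [e, add_zero]
          omega
      _ = ∑ i ∈ range m, (e i - e (i + 1)) := (sum_range_sub' e m).symm
      _ ≤ _ := sum_le_sum fun i _ => by
          have h1 := α.heightDiff_eq_psum (a + i)
          have h2 := β.heightDiff_eq_psum (a + i)
          have h3 := β.heightDiff_nonneg (a + i)
          simp only [e, ← add_assoc] at *
          rw [show a + i + 1 + 1 = a + i + 2 from rfl]
          omega
  obtain ⟨p, q, h1, h2, h3⟩ := exists_isDropPair_of_sum α.heightDiff_nonneg hsum
  exact ⟨p, q, h1, fun i hi hi' => hD i (by omega) (by omega)⟩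

/-- A partition is join-irreducible iff it has exactly one drop pair. -/
theorem supIrred_iff (α : ColPartition n) :
    SupIrred α ↔ (∃ p q, IsDropPair (heightDiff α.col) p q) ∧
      ∀ p q p' q', IsDropPair (heightDiff α.col) p q → IsDropPair (heightDiff α.col) p' q' →
        p = p' ∧ q = q' := by
  constructor
  · rintro ⟨hmin, hirr⟩
    refine ⟨?_, fun p q p' q' h h' => ?_⟩
    · obtain ⟨β, hβ⟩ := not_isMin_iff.1 hmin
      obtain ⟨p, q, h, -⟩ := exists_isDropPair_of_gt hβ
      exact ⟨p, q, h⟩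
    · by_contra hne
      obtain ⟨β, hβ⟩ := α.exists_psum_eq_sub h
      obtain ⟨β', hβ'⟩ := α.exists_psum_eq_sub h'
      have hlt : ∀ {p q : ℕ} {γ : ColPartition n}, IsDropPair (heightDiff α.col) p q →
          (∀ i, γ.psum i + (if p < i ∧ i ≤ q + 1 then 1 else 0) = α.psum i) → γ ≠ α := by
        rintro p q γ h hγ rfl
        have := hγ (p + 1)
        have := h.le
        rw [if_pos (by omega)] at *
        omega
      have h1 : β ≤ β ⊔ β' := le_sup_left
      have h2 : β' ≤ β ⊔ β' := le_sup_right
      have h3 : α ≤ β ⊔ β' := by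
        generalize β ⊔ β' = γ at h1 h2
        rw [le_iff_psum] at *
        have key : ∀ i, ¬((p < i ∧ i ≤ q + 1) ∧ (p' < i ∧ i ≤ q' + 1)) →
            α.psum i ≤ γ.psum i := fun i hi => by
          have a1 := hβ i
          have a2 := hβ' i
          have a3 := h1 i
          have a4 := h2 i
          split_ifs at * <;> omega
        intro i
        by_cases hi : (p < i ∧ i ≤ q + 1) ∧ (p' < i ∧ i ≤ q' + 1)
        · obtain ⟨j, rfl⟩ : ∃ j, i = j + 1 := ⟨i - 1, by omega⟩
          -- At the common index both moves lose a grain. The join still reaches `α` there: by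
          -- concavity twice its partial sum is at least twice that of `α` minus `d j = 1`, and
          -- integrality does the rest.
          obtain ⟨hj, hor⟩ := h.eq_one_of_overlap h' hne (j := j) (by omega) (by omega) (by omega)
            (by omega)
          have a1 := key j (by omega)
          have a2 := key (j + 2) (by omega)
          have a3 := γ.psum_concave j
          have a4 := α.heightDiff_eq_psum j
          omega
        · exact key i hi
      have h4 : β ⊔ β' = α := (sup_le (fun i => Nat.le.intro (hβ i))
        (fun i => Nat.le.intro (hβ' i))).antisymm h3
      rcases hirr h4 with h5 | h5
      · exact hlt h hβ h5
      · exact hlt h' hβ' h5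
  · rintro ⟨⟨p, q, h⟩, huniq⟩
    obtain ⟨β, hβ⟩ := α.exists_psum_eq_sub h
    have hβα : β ≤ α := fun i => Nat.le.intro (hβ i)
    have hαβ : ¬ α ≤ β := fun hc => by
      have h1 := hβ (p + 1)
      have h2 := le_iff_psum.1 hc (p + 1)
      have h3 := h.le
      rw [if_pos (by omega)] at h1
      omega
    -- The only drop pair makes `β` the greatest element strictly below `α`.
    have hle : ∀ γ, γ < α → γ ≤ β := fun γ hγ => by
      obtain ⟨p', q', h', hlt⟩ := exists_isDropPair_of_gt hγ
      obtain ⟨rfl, rfl⟩ := huniq _ _ _ _ h h'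
      refine le_iff_psum.2 fun i => ?_
      have h1 := hβ i
      have h2 := le_iff_psum.1 hγ.le i
      have h3 := hlt i
      split_ifs at h1 <;> omega
    refine ⟨fun hmin => hαβ (hmin hβα), fun b c hbc => ?_⟩
    by_contra! hne
    refine hαβ (hbc ▸ sup_le (hle b ?_) (hle c ?_))
    · exact lt_of_le_of_ne (hbc ▸ le_sup_left) hne.1
    · exact lt_of_le_of_ne (hbc ▸ le_sup_right) hne.2

end ColPartition

/-! ### Shapes of join-irreducible partitions -/

/-- The column heights of a diagram with one row of length `p`, `c` rows of length `q` and one row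
of length `r`. -/
def shape (p c q r : ℕ) : ℕ → ℕ := fun i =>
  (if i < p then 1 else 0) + (if i < q then c else 0) + (if i < r then 1 else 0)

theorem heightDiff_shape (p c q r i : ℕ) : heightDiff (shape p c q r) i =
    (if i + 1 = p then 1 else 0) + (if i + 1 = q then (c : ℤ) else 0) +
      (if i + 1 = r then 1 else 0) := by
  simp only [heightDiff, shape]
  split_ifs <;> push_cast <;> omega

theorem antitone_shape (p c q r : ℕ) : Antitone (shape p c q r) := by
  refine antitone_nat_of_succ_le fun i => ?_
  simp only [shape]
  split_ifs <;> omega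

theorem sum_shape {p c q r n : ℕ} (hp : p ≤ n) (hq : q ≤ n) (hr : r ≤ n) :
    ∑ i ∈ range n, shape p c q r i = p + c * q + r := by
  have key : ∀ c q, q ≤ n → ∑ i ∈ range n, (if i < q then c else 0) = c * q := fun c q hq => by
    rw [← sum_filter, show (range n).filter (· < q) = range q by ext; simp; omega]
    simp [mul_comm]
  simp only [shape, sum_add_distrib, key _ _ hp, key _ _ hq, key _ _ hr, one_mul]

/-- Normalized parameters of the shapes of join-irreducible partitions. -/
def ValidShape (p c q r : ℕ) : Prop :=
  1 ≤ c ∧ p < q ∧ (r = 0 ∨ q < r) ∧ (c = 1 → 1 ≤ p ∧ r = 0)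

theorem ValidShape.le_mul {p c q r : ℕ} (h : ValidShape p c q r) : q ≤ c * q :=
  Nat.le_mul_of_pos_left q h.1

theorem ValidShape.isDropPair_iff {p c q r : ℕ} (h : ValidShape p c q r) (i j : ℕ) :
    IsDropPair (heightDiff (shape p c q r)) i j ↔
      j + 1 = q ∧ (2 ≤ c ∧ i + 1 = q ∨ c = 1 ∧ i + 1 = p) := by
  unfold ValidShape at h
  unfold IsDropPair
  simp only [heightDiff_shape]
  constructor
  · rintro (⟨rfl, h1⟩ | ⟨h1, h2, h3, h4⟩)
    · grind
    · have h5 := h4 (q - 1)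
      grind
  · rintro ⟨rfl, h1 | h1⟩
    · grind
    · refine .inr ?_
      grind

theorem ValidShape.shape_injective {p c q r p' c' q' r' : ℕ} (h : ValidShape p c q r)
    (h' : ValidShape p' c' q' r') (heq : shape p c q r = shape p' c' q' r') :
    p = p' ∧ c = c' ∧ q = q' ∧ r = r' := by
  have key : ∀ i, 1 ≤ i → (if i = p then 1 else 0) + (if i = q then (c : ℤ) else 0) +
      (if i = r then 1 else 0) = (if i = p' then 1 else 0) + (if i = q' then (c' : ℤ) else 0) +
      (if i = r' then 1 else 0) := fun i hi => by
    have := congrArg (heightDiff · (i - 1)) heq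
    simpa only [heightDiff_shape, Nat.sub_add_cancel hi] using this
  -- The lower end of the drop pair determines `q`.
  have hq : q = q' := by
    obtain ⟨u, hu⟩ : ∃ u, IsDropPair (heightDiff (shape p c q r)) u (q - 1) := by
      simp only [h.isDropPair_iff]
      unfold ValidShape at h
      by_cases hc : c = 1
      · exact ⟨p - 1, by omega⟩
      · exact ⟨q - 1, by omega⟩
    rw [heq, h'.isDropPair_iff] at hu
    have := h.2.1
    omega
  unfold ValidShape at h h'
  subst hq
  have hc : c = c' := by
    have h1 := key q
    grind
  subst hc
  have h1 := key p
  have h2 := key p'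
  have h3 := key r
  have h4 := key r'
  grind

/-- Eventually vanishing sequences with the same differences are equal. -/
theorem eq_of_heightDiff_eq {a b : ℕ → ℕ} {n : ℕ} (ha : ∀ i, n ≤ i → a i = 0)
    (hb : ∀ i, n ≤ i → b i = 0) (h : ∀ i, heightDiff a i = heightDiff b i) : a = b := by
  have key : ∀ k i, n ≤ i + k → a i = b i := by
    intro k
    induction k with
    | zero => intro i hi; rw [ha i hi, hb i hi]
    | succ k ih =>
      intro i hi
      have h1 := ih (i + 1) (by omega)
      have h2 := h i
      simp only [heightDiff] at h2
      omega
  exact funext fun i => key n i (by omega)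

theorem exists_validShape {d : ℕ → ℤ} (hd : ∀ i, 0 ≤ d i) (hex : ∃ i j, IsDropPair d i j)
    (huniq : ∀ i j i' j', IsDropPair d i j → IsDropPair d i' j' → i = i' ∧ j = j') :
    ∃ p c q r, ValidShape p c q r ∧ ∀ i, d i = heightDiff (shape p c q r) i := by
  obtain ⟨u, v, h⟩ := hex
  simp only [heightDiff_shape]
  -- Any two descents enclose the unique drop pair, so no two lie on the same side of it.
  have two : ∀ i j, i < j → 1 ≤ d i → 1 ≤ d j → i ≤ u ∧ v ≤ j := fun i j hij hi hj => by
    obtain ⟨i', j', h', h1, h2⟩ := exists_isDropPair_of_lt hd hij hi hj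
    have := huniq _ _ _ _ h h'
    omega
  have big : ∀ i, 2 ≤ d i → i = u ∧ i = v := fun i hi => by
    have := huniq _ _ _ _ h (.inl ⟨rfl, hi⟩ : IsDropPair d i i)
    omega
  have hd1 : ∀ i, d i = 0 ∨ d i = 1 ∨ 2 ≤ d i := fun i => by have := hd i; omega
  rcases h with ⟨rfl, h⟩ | ⟨h0, h1, h2, h3⟩
  · obtain ⟨c, hc⟩ : ∃ c : ℕ, d u = c := ⟨(d u).toNat, by omega⟩
    obtain ⟨p, hp, hpd⟩ : ∃ p, p < u + 1 ∧
        ∀ i, i < u → d i = if i + 1 = p then 1 else 0 := by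
      by_cases hex : ∃ i, i < u ∧ d i ≠ 0
      · obtain ⟨i, hi, hi0⟩ := hex
        refine ⟨i + 1, by omega, fun j hj => ?_⟩
        grind
      · exact ⟨0, by omega, fun i hi => by grind⟩
    obtain ⟨r, hr, hrd⟩ : ∃ r, (r = 0 ∨ u + 1 < r) ∧
        ∀ i, u < i → d i = if i + 1 = r then 1 else 0 := by
      by_cases hex : ∃ i, u < i ∧ d i ≠ 0
      · obtain ⟨i, hi, hi0⟩ := hex
        refine ⟨i + 1, by omega, fun j hj => ?_⟩
        grind
      · exact ⟨0, by omega, fun i hi => by grind⟩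
    refine ⟨p, c, u + 1, r, by unfold ValidShape; omega, fun i => ?_⟩
    grind
  · refine ⟨u + 1, 1, v + 1, 0, by unfold ValidShape; omega, fun i => ?_⟩
    rcases lt_trichotomy i u with hi | rfl | hi
    · grind
    · grind
    · rcases lt_trichotomy i v with hi' | rfl | hi' <;> grind

/-- The sequences of the join-irreducible partitions of `n`. -/
theorem mem_image_joinIrreducibles {n : ℕ} {f : ℕ → ℕ} :
    f ∈ ColPartition.col '' joinIrreducibles n ↔
      ∃ p c q r, ValidShape p c q r ∧ p + c * q + r = n ∧ f = shape p c q r := by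
  constructor
  · rintro ⟨α, hα, rfl⟩
    obtain ⟨hex, huniq⟩ := (ColPartition.supIrred_iff α).1 hα
    obtain ⟨p, c, q, r, hv, hd⟩ := exists_validShape α.heightDiff_nonneg hex huniq
    have hcol : α.col = shape p c q r := by
      refine eq_of_heightDiff_eq (n := n + p + q + r) (fun i hi => α.col_eq_zero i (by omega))
        (fun i hi => ?_) hd
      simp only [shape]
      split_ifs <;> omega
    refine ⟨p, c, q, r, hv, ?_, hcol⟩
    have h0 : ∀ i, n ≤ i → shape p c q r i = 0 := hcol ▸ α.col_eq_zero
    have h1 := h0 n le_rfl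
    have h2 := α.sum_col
    have h3 : p ≤ n ∧ q ≤ n ∧ r ≤ n := by
      have := hv.1
      simp only [shape] at h1
      split_ifs at h1 <;> omega
    rwa [hcol, sum_shape h3.1 h3.2.1 h3.2.2] at h2
  · rintro ⟨p, c, q, r, hv, hn, rfl⟩
    have hq := hv.le_mul
    refine ⟨⟨shape p c q r, antitone_shape p c q r, fun i hi => ?_, ?_⟩, ?_, rfl⟩
    · simp only [shape]
      split_ifs <;> omega
    · rw [sum_shape (by omega) (by omega) (by omega), hn]
    · refine (ColPartition.supIrred_iff _).2 ?_
      simp only [hv.isDropPair_iff]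
      unfold ValidShape at hv
      refine ⟨?_, by omega⟩
      by_cases hc : c = 1
      · exact ⟨p - 1, q - 1, by omega⟩
      · exact ⟨q - 1, q - 1, by omega⟩

/-! ### The classes at the first column in terms of the parameters -/

theorem ValidShape.hasCliff_iff {p c q r : ℕ} (h : ValidShape p c q r) :
    HasCliff (shape p c q r) 0 ↔ q = 1 := by
  unfold ValidShape at h
  simp only [HasCliff, heightDiff_shape]
  split_ifs <;> omega

theorem ValidShape.hasNonSlipperyPlateau_iff {p c q r : ℕ} (h : ValidShape p c q r) :
    HasNonSlipperyPlateau (shape p c q r) 0 ↔ p = 0 ∧ 2 ≤ c ∧ 2 ≤ q := by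
  unfold ValidShape at h
  simp only [HasNonSlipperyPlateau, HasCliff, heightDiff_shape]
  constructor
  · rintro ⟨k, h1, h2, h3⟩
    have h4 := h2 (p - 1)
    grind
  · rintro ⟨rfl, hc, hq⟩
    exact ⟨q - 1, by omega, fun i _ hi => by grind, by grind⟩

theorem ValidShape.hasSlipperyPlateau_iff {p c q r l : ℕ} (h : ValidShape p c q r) :
    HasSlipperyPlateau (shape p c q r) 0 l ↔ p = l + 1 ∧ 1 ≤ l := by
  unfold ValidShape at h
  simp only [HasSlipperyPlateau, heightDiff_shape]
  constructor
  · rintro ⟨k, h1, h2, h3, rfl⟩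
    have h4 := h2 (p - 1)
    have h5 := h2 (q - 1)
    grind
  · rintro ⟨rfl, hl⟩
    exact ⟨l, by omega, fun i _ hi => by grind, by grind, by omega⟩

theorem heightDiff_removeGrain {a : ℕ → ℕ} (h : 1 ≤ a 0) (i : ℕ) :
    heightDiff (removeGrain 0 a) i = heightDiff a i - if i = 0 then 1 else 0 := by
  rcases i with _ | i
  · simp [heightDiff, removeGrain]
    omega
  · simp [heightDiff, removeGrain]

theorem canRemoveGrain_shape_one (c q r : ℕ) : CanRemoveGrain (shape 1 c q r) 0 := by
  refine ⟨by simp only [shape]; split_ifs <;> omega, ?_⟩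
  have : removeGrain 0 (shape 1 c q r) = shape 0 c q r := by
    funext i
    simp only [removeGrain, Function.update_apply, shape]
    split_ifs <;> subst_vars <;> omega
  rw [this]
  exact antitone_shape _ _ _ _

/-- A plateau appears only if the removed grain was a whole row of length 1; it then ends at the
drop of height `c` behind the middle rows, slippery iff `c = 1`. -/
theorem ValidShape.hasSlipperyStep_iff {p c q r : ℕ} (h : ValidShape p c q r) :
    HasSlipperyStep (shape p c q r) 0 ↔ p = 1 ∧ c = 1 := by
  unfold ValidShape at h
  constructor
  · rintro ⟨⟨h0, -⟩, l, k, h1, h2, h3, -⟩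
    simp only [heightDiff_removeGrain h0, heightDiff_shape] at h2 h3
    have h4 := h2 0 le_rfl h1
    obtain rfl : p = 1 := by grind
    obtain ⟨u, rfl⟩ : ∃ u, q = u + 1 := ⟨q - 1, by omega⟩
    have h5 := h2 u (Nat.zero_le _)
    grind
  · rintro ⟨rfl, rfl⟩
    have hc := canRemoveGrain_shape_one 1 q r
    refine ⟨hc, q - 1, q - 1, by omega, fun i _ hi => ?_, ?_, by omega⟩ <;>
    · rw [heightDiff_removeGrain hc.1, heightDiff_shape]
      grind

theorem ValidShape.hasNonSlipperyStep_iff {p c q r : ℕ} (h : ValidShape p c q r) :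
    HasNonSlipperyStep (shape p c q r) 0 ↔ p = 1 ∧ 2 ≤ c := by
  unfold ValidShape at h
  constructor
  · rintro ⟨⟨h0, -⟩, k, h1, h2, h3⟩
    simp only [HasCliff, heightDiff_removeGrain h0, heightDiff_shape] at h2 h3
    have h4 := h2 0 le_rfl h1
    grind
  · rintro ⟨rfl, h2⟩
    have hc := canRemoveGrain_shape_one c q r
    refine ⟨hc, q - 1, by omega, fun i _ hi => ?_, ?_⟩
    · rw [heightDiff_removeGrain hc.1, heightDiff_shape]
      grind
    · rw [HasCliff, heightDiff_removeGrain hc.1, heightDiff_shape]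
      grind

/-! ### Adding a grain to a class of shapes -/

/-- The shapes of size `n` with valid parameters satisfying `C`. -/
def shapesWith (C : ℕ → ℕ → ℕ → ℕ → Prop) (n : ℕ) : Set (ℕ → ℕ) :=
  {f | ∃ p c q r, ValidShape p c q r ∧ p + c * q + r = n ∧ C p c q r ∧ f = shape p c q r}

theorem disjoint_shapesWith {C C' : ℕ → ℕ → ℕ → ℕ → Prop} {n : ℕ}
    (h : ∀ p c q r, ValidShape p c q r → C p c q r → ¬ C' p c q r) :
    Disjoint (shapesWith C n) (shapesWith C' n) := by
  rw [Set.disjoint_left]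
  rintro f ⟨p, c, q, r, hv, -, hC, rfl⟩ ⟨p', c', q', r', hv', -, hC', heq⟩
  obtain ⟨rfl, rfl, rfl, rfl⟩ := hv.shape_injective hv' heq
  exact h p c q r hv hC hC'

theorem shapesWith_union (C C' : ℕ → ℕ → ℕ → ℕ → Prop) (n : ℕ) :
    shapesWith C n ∪ shapesWith C' n =
      shapesWith (fun p c q r => C p c q r ∨ C' p c q r) n := by
  ext f
  constructor
  · rintro (⟨p, c, q, r, hv, hn, hC, rfl⟩ | ⟨p, c, q, r, hv, hn, hC, rfl⟩)
    · exact ⟨p, c, q, r, hv, hn, .inl hC, rfl⟩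
    · exact ⟨p, c, q, r, hv, hn, .inr hC, rfl⟩
  · rintro ⟨p, c, q, r, hv, hn, hC | hC, rfl⟩
    · exact .inl ⟨p, c, q, r, hv, hn, hC, rfl⟩
    · exact .inr ⟨p, c, q, r, hv, hn, hC, rfl⟩

theorem biUnion_shapesWith (S : Set ℕ) (C : ℕ → ℕ → ℕ → ℕ → ℕ → Prop) (n : ℕ) :
    ⋃ l ∈ S, shapesWith (C l) n = shapesWith (fun p c q r => ∃ l ∈ S, C l p c q r) n := by
  ext f
  simp only [Set.mem_iUnion]
  constructor
  · rintro ⟨l, hl, p, c, q, r, hv, hn, hC, rfl⟩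
    exact ⟨p, c, q, r, hv, hn, ⟨l, hl, hC⟩, rfl⟩
  · rintro ⟨p, c, q, r, hv, hn, ⟨l, hl, hC⟩, rfl⟩
    exact ⟨l, hl, p, c, q, r, hv, hn, hC, rfl⟩

theorem image_joinIrreducibles_eq (n : ℕ) :
    ColPartition.col '' joinIrreducibles n = shapesWith (fun _ _ _ _ => True) n := by
  ext f
  rw [mem_image_joinIrreducibles]
  simp only [shapesWith, true_and, Set.mem_ofPred_eq]

theorem mem_grainImage {n i : ℕ} {X : Set (ColPartition n)} {C : ℕ → ℕ → ℕ → ℕ → Prop}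
    (hX : ∀ α : ColPartition n, ∀ p c q r, ValidShape p c q r → α.col = shape p c q r →
      (α ∈ X ↔ C p c q r)) {f : ℕ → ℕ} :
    f ∈ grainImage (joinIrreducibles n ∩ X) i ↔
      ∃ p c q r, ValidShape p c q r ∧ p + c * q + r = n ∧ C p c q r ∧
        f = fun j => if j + 1 = i then shape p c q r j + 1 else shape p c q r j := by
  constructor
  · rintro ⟨α, ⟨hα, hαX⟩, rfl⟩
    obtain ⟨p, c, q, r, hv, hn, heq⟩ := mem_image_joinIrreducibles.1 ⟨α, hα, rfl⟩
    exact ⟨p, c, q, r, hv, hn, (hX α p c q r hv heq).1 hαX, by rw [← heq]; rfl⟩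
  · rintro ⟨p, c, q, r, hv, hn, hC, rfl⟩
    obtain ⟨α, hα, heq⟩ := mem_image_joinIrreducibles.2 ⟨p, c, q, r, hv, hn, rfl⟩
    exact ⟨α, ⟨hα, (hX α p c q r hv heq).2 hC⟩, by rw [← heq]; rfl⟩

/-- Here `q = 1` forces `p = 0` and `c ≥ 2`, so the grain is a new row of length 1 and always joins
the middle rows. -/
theorem grainImage_Cl (n : ℕ) : grainImage (joinIrreducibles n ∩ Cl n) 1 =
    shapesWith (fun p c q _ => p = 0 ∧ q = 1 ∧ 3 ≤ c) (n + 1) := by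
  have hgrain : ∀ c r, (fun j => if j + 1 = 1 then shape 0 c 1 r j + 1 else shape 0 c 1 r j) =
      shape 0 (c + 1) 1 r := fun c r => by
    funext j
    simp only [shape]
    split_ifs <;> omega
  ext f
  rw [mem_grainImage (C := fun _ _ q _ => q = 1)
    fun α p c q r hv h => by rw [← hv.hasCliff_iff, ← h]; rfl]
  constructor
  · rintro ⟨p, c, q, r, hv, hn, rfl, rfl⟩
    unfold ValidShape at hv
    obtain rfl : p = 0 := by omega
    exact ⟨0, c + 1, 1, r, by unfold ValidShape; omega, by omega, by omega, hgrain c r⟩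
  · rintro ⟨p, c, q, r, hv, hn, ⟨rfl, rfl, hc⟩, rfl⟩
    obtain ⟨c, rfl⟩ : ∃ d, c = d + 1 := ⟨c - 1, by omega⟩
    unfold ValidShape at hv
    exact ⟨0, c, 1, r, by unfold ValidShape; omega, by omega, rfl, (hgrain c r).symm⟩

/-- Adding a grain right below the shortest row of a class of shapes lengthens this row, which may
thereby reach the length of the middle rows. -/
theorem grainImage_eq_shapesWith {n k : ℕ} {X : Set (ColPartition n)} {D : ℕ → ℕ → Prop}
    (hD : ∀ q, D 1 q → 1 ≤ k)
    (hX : ∀ α : ColPartition n, ∀ p c q r, ValidShape p c q r → α.col = shape p c q r →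
      (α ∈ X ↔ p = k ∧ D c q)) :
    grainImage (joinIrreducibles n ∩ X) (k + 1) =
      shapesWith (fun p c q r => p = k + 1 ∧ D c q ∨
        p = 0 ∧ q = k + 1 ∧ D (c - 1) q ∧ (c = 2 → r = 0)) (n + 1) := by
  have hgrain : ∀ c q r, (fun j => if j + 1 = k + 1 then shape k c q r j + 1
      else shape k c q r j) = shape (k + 1) c q r := fun c q r => by
    funext j
    simp only [shape]
    split_ifs <;> omega
  have hmerge : ∀ c r, shape (k + 1) c (k + 1) r = shape 0 (c + 1) (k + 1) r := fun c r => by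
    funext j
    simp only [shape]
    split_ifs <;> omega
  ext f
  rw [mem_grainImage (C := fun p c q _ => p = k ∧ D c q) hX]
  constructor
  · rintro ⟨p, c, q, r, hv, hn, ⟨rfl, hC⟩, rfl⟩
    have hv' := hv
    unfold ValidShape at hv'
    rw [hgrain]
    obtain rfl | hq : q = p + 1 ∨ p + 1 < q := by omega
    -- If the merged shape has two middle rows, it had `c = 1` before, which excludes a long row;
    -- hence the clause `c = 2 → r = 0`.
    · refine ⟨0, c + 1, p + 1, r, by unfold ValidShape; omega, ?_,
        .inr ⟨rfl, rfl, hC, by omega⟩, hmerge c r⟩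
      rw [Nat.add_mul]
      omega
    · exact ⟨p + 1, c, q, r, by unfold ValidShape; omega, by omega, .inl ⟨rfl, hC⟩, rfl⟩
  · rintro ⟨p, c, q, r, hv, hn, ⟨rfl, hC⟩ | ⟨rfl, rfl, hC, hr⟩, rfl⟩
    · refine ⟨k, c, q, r, ?_, by omega, ⟨rfl, hC⟩, (hgrain c q r).symm⟩
      -- With `c = 1` the short row must be present for the shape before the move to be valid.
      have h1 : c = 1 → 1 ≤ k := fun h => hD q (h ▸ hC)
      unfold ValidShape at *
      omega
    · unfold ValidShape at hv
      obtain ⟨c, rfl⟩ : ∃ d, c = d + 1 := ⟨c - 1, by omega⟩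
      rw [Nat.add_sub_cancel] at hC
      have h1 : c = 1 → 1 ≤ k := fun h => hD _ (h ▸ hC)
      refine ⟨k, c, k + 1, r, by unfold ValidShape; omega, ?_, ⟨rfl, hC⟩, ?_⟩
      · rw [Nat.add_mul] at hn
        omega
      · rw [hgrain, hmerge]

theorem grainImage_NP (n : ℕ) : grainImage (joinIrreducibles n ∩ NP n) 1 =
    shapesWith (fun p c q r => p = 1 ∧ (2 ≤ c ∧ 2 ≤ q) ∨
      p = 0 ∧ q = 1 ∧ (2 ≤ c - 1 ∧ 2 ≤ q) ∧ (c = 2 → r = 0)) (n + 1) :=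
  grainImage_eq_shapesWith (k := 0) (D := fun c q => 2 ≤ c ∧ 2 ≤ q) (fun q h => by omega)
    fun α p c q r hv h => by rw [← hv.hasNonSlipperyPlateau_iff, ← h]; rfl

theorem grainImage_SS (n : ℕ) : grainImage (joinIrreducibles n ∩ SS n) 2 =
    shapesWith (fun p c q r => p = 2 ∧ c = 1 ∨
      p = 0 ∧ q = 2 ∧ c - 1 = 1 ∧ (c = 2 → r = 0)) (n + 1) :=
  grainImage_eq_shapesWith (k := 1) (D := fun c _ => c = 1) (fun q h => le_rfl)
    fun α p c q r hv h => by rw [← hv.hasSlipperyStep_iff, ← h]; rfl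

theorem grainImage_NS (n : ℕ) : grainImage (joinIrreducibles n ∩ NS n) 2 =
    shapesWith (fun p c q r => p = 2 ∧ 2 ≤ c ∨
      p = 0 ∧ q = 2 ∧ 2 ≤ c - 1 ∧ (c = 2 → r = 0)) (n + 1) :=
  grainImage_eq_shapesWith (k := 1) (D := fun c _ => 2 ≤ c) (fun q h => le_rfl)
    fun α p c q r hv h => by rw [← hv.hasNonSlipperyStep_iff, ← h]; rfl

theorem grainImage_PP (l n : ℕ) : grainImage (joinIrreducibles n ∩ PP l n) (l + 2) =
    shapesWith (fun p c q r => p = l + 2 ∧ 1 ≤ l ∨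
      p = 0 ∧ q = l + 2 ∧ 1 ≤ l ∧ (c = 2 → r = 0)) (n + 1) :=
  grainImage_eq_shapesWith (k := l + 1) (D := fun _ _ => 1 ≤ l) (fun q h => by omega)
    fun α p c q r hv h => by rw [← hv.hasSlipperyPlateau_iff, ← h]; rfl

/-- The rows have lengths 1 and `k - 1`; the bound on `k` keeps them distinct. -/
theorem E₁_eq {k : ℕ} (hk : 3 ≤ k) : E₁ k = shapesWith (fun p c _ _ => p = 1 ∧ c = 1) k := by
  have key : tuple (2 :: List.replicate (k - 2) 1) = shape 1 1 (k - 1) 0 := by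
    funext i
    rcases i with _ | i
    · simp only [tuple, shape, List.getD_cons_zero]
      split_ifs <;> omega
    · simp only [tuple, shape, List.getD_eq_getElem?_getD, List.getElem?_cons_succ,
        List.getElem?_replicate]
      split_ifs <;> simp <;> omega
  ext f
  rw [E₁, Set.mem_singleton_iff, key]
  constructor
  · rintro rfl
    exact ⟨1, 1, k - 1, 0, by unfold ValidShape; omega, by omega, ⟨rfl, rfl⟩, rfl⟩
  · rintro ⟨p, c, q, r, hv, hk, ⟨rfl, rfl⟩, rfl⟩
    unfold ValidShape at hv
    obtain rfl : q = k - 1 := by omega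
    obtain rfl : r = 0 := by omega
    rfl

theorem E₂_eq (k : ℕ) : E₂ k = shapesWith (fun p c _ r => p = 0 ∧ c = 2 ∧ 1 ≤ r) k := by
  have key : ∀ m l, tuple (List.replicate m 3 ++ List.replicate l 1) = shape 0 2 m (m + l) := by
    intro m l
    funext i
    simp only [tuple, shape, List.getD_eq_getElem?_getD, List.getElem?_append,
      List.getElem?_replicate, List.length_replicate]
    split_ifs <;> simp <;> omega
  ext f
  constructor
  · rintro ⟨m, l, hm, hl, hk, rfl⟩
    exact ⟨0, 2, m, m + l, by unfold ValidShape; omega, by omega, by omega, key m l⟩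
  · rintro ⟨p, c, q, r, hv, hk, ⟨rfl, rfl, hr⟩, rfl⟩
    unfold ValidShape at hv
    refine ⟨q, r - q, by omega, by omega, by omega, ?_⟩
    rw [key, show q + (r - q) = r by omega]

/-! ### The recursion as a case distinction on the parameters -/

/-- Both sides of the equation are sets of zero-prolonged tuples; the other two conjuncts say that
the union is disjoint. -/
theorem mainTheorem3 (n : ℕ) (hn : 3 ≤ n) :
    ColPartition.col '' joinIrreducibles (n + 1) =
        grainImage (joinIrreducibles n ∩ Cl n) 1 ∪
        grainImage (joinIrreducibles n ∩ NP n) 1 ∪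
        grainImage (joinIrreducibles n ∩ SS n) 2 ∪
        grainImage (joinIrreducibles n ∩ NS n) 2 ∪
        (⋃ l ∈ Set.Ico 1 n, grainImage (joinIrreducibles n ∩ PP l n) (l + 2)) ∪
        E₁ (n + 1) ∪ E₂ (n + 1) ∧
      List.Pairwise Disjoint
        [grainImage (joinIrreducibles n ∩ Cl n) 1,
         grainImage (joinIrreducibles n ∩ NP n) 1,
         grainImage (joinIrreducibles n ∩ SS n) 2,
         grainImage (joinIrreducibles n ∩ NS n) 2,
         ⋃ l ∈ Set.Ico 1 n, grainImage (joinIrreducibles n ∩ PP l n) (l + 2),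
         E₁ (n + 1), E₂ (n + 1)] ∧
      (Set.Ico 1 n).PairwiseDisjoint
        (fun l => grainImage (joinIrreducibles n ∩ PP l n) (l + 2)) := by
  simp only [image_joinIrreducibles_eq, grainImage_Cl, grainImage_NP, grainImage_SS,
    grainImage_NS, grainImage_PP, E₁_eq (show 3 ≤ n + 1 by omega), E₂_eq, biUnion_shapesWith,
    shapesWith_union]
  refine ⟨?_, ?_, fun l _ l' _ hll' => ?_⟩
  · ext f
    constructor
    · rintro ⟨p, c, q, r, hv, hsum, -, rfl⟩
      refine ⟨p, c, q, r, hv, hsum, ?_, rfl⟩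
      have hle := hv.le_mul
      -- The bound `l < n` is automatic, since `l + 2` is the length of a row of a shape of size `n
      -- + 1`.
      have hPP : (∃ l ∈ Set.Ico 1 n, p = l + 2 ∧ 1 ≤ l ∨
          p = 0 ∧ q = l + 2 ∧ 1 ≤ l ∧ (c = 2 → r = 0)) ↔
          3 ≤ p ∨ p = 0 ∧ 3 ≤ q ∧ (c = 2 → r = 0) := by
        unfold ValidShape at hv
        constructor
        · rintro ⟨l, -, h⟩
          omega
        · rintro (h | h)
          · exact ⟨p - 2, ⟨by omega, by omega⟩, by omega⟩
          · exact ⟨q - 2, ⟨by omega, by omega⟩, by omega⟩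
      beta_reduce
      rw [hPP]
      unfold ValidShape at hv
      -- Linearizes the size for `q = 1`, so that `p = r = 0`, `c = 2` is excluded by its size 2.
      have hq1 : q = 1 → c * q = c := fun h => by rw [h, mul_one]
      omega
    · rintro ⟨p, c, q, r, hv, hsum, -, rfl⟩
      exact ⟨p, c, q, r, hv, hsum, trivial, rfl⟩
  · simp only [List.pairwise_cons, List.mem_cons, List.not_mem_nil, or_false, forall_eq_or_imp,
      forall_eq, IsEmpty.forall_iff, implies_true, List.Pairwise.nil, and_true]
    refine ⟨⟨?_, ?_, ?_, ?_, ?_, ?_⟩, ⟨?_, ?_, ?_, ?_, ?_⟩, ⟨?_, ?_, ?_, ?_⟩, ⟨?_, ?_, ?_⟩,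
      ⟨?_, ?_⟩, ?_⟩ <;> refine disjoint_shapesWith fun p c q r hv h h' => ?_ <;>
      unfold ValidShape at hv <;>
      omega
  · refine disjoint_shapesWith fun p c q r hv h h' => ?_
    omega
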